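/- For $\mathbf A=(\mathbf a_1,\ldots,\mathbf a_m)^\top\in\mathbb R^{m\times d}$ and $\mathbf b=(b_1,\ldots,b_m)^\top\in\mathbb R^m$, identify the pair $(\mathbf A,\mathbf b)$ with an element of $\mathbb R^{m\times(d+1)}$ and let $$\mathbf M_{\mathbf A,\mathbf b}(\mathbf x)=\bigl(|\langle \mathbf a_1,\mathbf x\rangle+b_1|,\ldots,|\langle \mathbf a_m,\mathbf x\rangle+b_m|\bigr),\qquad \mathbf x\in\mathbb R^d.$$ Let $s\ge 0$ be an integer, and let $\Sigma_s(\mathbb R^d)$ be the set of vectors in $\mathbb R^d$ with at most $s$ nonzero entries. Say that $(\mathbf A,\mathbf b)$ is $s$-sparse affine phase retrievable for $\mathbb R^d$ if $\mathbf M_{\mathbf A,\mathbf b}$ is injective on $\Sigma_s(\mathbb R^d)$. (i) If $1\le s\le d-1$ and $(\mathbf A,\mathbf b)\in\mathbb R^{m\times(d+1)}$ is $s$-sparse affine phase retrievable for $\mathbb R^d$, then $m\ge 2s+1$. (ii) If $m\ge 2s+1$, then a generic $(\mathbf A,\mathbf b)\in\mathbb R^{m\times(d+1)}$ is $s$-sparse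 affine phase retrievable for $\mathbb R^d$; that is, there is a dense open set $X\subset\mathbb R^{m\times(d+1)}$ whose complement has Lebesgue measure zero such that every $(\mathbf A,\mathbf b)\in X$ is $s$-sparse affine phase retrievable for $\mathbb R^d$. -/

import Mathlib

open MeasureTheory

/-- The affine phaseless measurement map `M_{A,b}(x) = (|⟨a_1, x⟩ + b_1|, …, |⟨a_m, x⟩ + b_m|)` on
`ℝ^d`, where `a_j = A j` is the `j`-th row of the measurement matrix `A ∈ ℝ^{m×d}`. -/
def affineMeasurement {m d : ℕ} (A : Fin m → Fin d → ℝ) (b : Fin m → ℝ) (x : Fin d → ℝ) :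
    Fin m → ℝ :=
  fun j => |A j ⬝ᵥ x + b j|

/-- The set `Σ_s(ℝ^d)` of vectors with at most `s` nonzero entries. -/
def sparseVectors (s d : ℕ) : Set (Fin d → ℝ) :=
  {x | hammingNorm x ≤ s}

/-- `(A, b)` is `s`-sparse affine phase retrievable for `ℝ^d`: the map `M_{A,b}` is injective on
`Σ_s(ℝ^d)`. -/
def IsSparseAffinePhaseRetrievable {m d : ℕ} (s : ℕ) (A : Fin m → Fin d → ℝ) (b : Fin m → ℝ) :
    Prop :=
  Set.InjOn (affineMeasurement A b) (sparseVectors s d)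

/-- A property `P` holds for a generic element of `E`: it holds at every point of some dense open
set whose complement is a null set. -/
def HoldsGenerically {E : Type*} [TopologicalSpace E] [MeasureSpace E] (P : E → Prop) : Prop :=
  ∃ X : Set E, IsOpen X ∧ Dense X ∧ volume Xᶜ = 0 ∧ ∀ u ∈ X, P u

/-! The proof rewrites `|⟨a_j, x⟩ + b_j| = |⟨a_j, y⟩ + b_j|` in terms of `u = x - y` and
`v = x + y`: the two measurements agree if and only if, for some set `I` of indices,
`⟨a_j, u⟩ = 0` for `j ∈ I` and `⟨a_j, v⟩ + 2 b_j = 0` for `j ∉ I`.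

*Necessity.* One may assume `d = s + 1`, so that a vector is `s`-sparse once a coordinate vanishes.
If `A` has a nonzero kernel, split a kernel vector into two sparse pieces. Otherwise choose `s + 1`
independent rows of `A`; the corresponding equations `⟨a_j, v⟩ + 2 b_j = 0` have a solution `v`.
When `m ≤ 2 s`, at most `s - 1` rows remain, so the space `K` of all `u` orthogonal to them has
dimension at least two. A nonzero `u ∈ K` such that `u + v` and `v - u` both have a vanishing
coordinate is then found by elementary linear algebra
(`exists_ne_zero_add_eq_zero_and_sub_eq_zero`).

*Sufficiency.* Injectivity of a matrix depending linearly on a parameter is generic as soon as it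
holds for one parameter (`holdsGenerically_injOn_of_exists`): with `Φ` a left inverse of `L e₀`,
the polynomial `e ↦ det (Φ ∘ L e)` is, along each line parallel to `e₀`, a characteristic
polynomial, so it has finitely many zeros there. There are finitely many choices of `I` and of the
supports `S`, `T` of `x`, `y`. For each of them the system above, in the unknowns `(u, v, τ)` with
`τ` multiplying `b`, is shown to have no solution with `u ≠ 0` and `τ ≠ 0`, for generic `(A, b)`.
Depending on the size of `I` relative to `S ∩ T` and `S ∪ T`, this follows from generic injectivity
on the space of all `u`, of all `(v, τ)`, or of all `(u, v, τ)`; a parameter with coordinate rows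
(`exists_eq_zero_of_splitSystem_eq_zero`) shows that injectivity is attained. -/

/-! ### Generic properties -/

theorem HoldsGenerically.mono {E : Type*} [TopologicalSpace E] [MeasureSpace E] {P Q : E → Prop}
    (h : HoldsGenerically P) (hPQ : ∀ e, P e → Q e) : HoldsGenerically Q := by
  obtain ⟨X, h1, h2, h3, h4⟩ := h
  exact ⟨X, h1, h2, h3, fun u hu => hPQ u (h4 u hu)⟩

theorem HoldsGenerically.of_isOpen_of_ae {E : Type*} [TopologicalSpace E] [MeasureSpace E]
    [(volume : Measure E).IsOpenPosMeasure] {P : E → Prop} {X : Set E} (hX : IsOpen X)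
    (hae : ∀ᵐ e, e ∈ X) (hP : ∀ e ∈ X, P e) : HoldsGenerically P :=
  ⟨X, hX, Measure.dense_of_ae hae, hae, hP⟩

theorem HoldsGenerically.forall_finite {E : Type*} [TopologicalSpace E] [MeasureSpace E]
    [(volume : Measure E).IsOpenPosMeasure] {ι : Type*} [Finite ι] {P : ι → E → Prop}
    (h : ∀ i, HoldsGenerically (P i)) : HoldsGenerically (fun e => ∀ i, P i e) := by
  choose X h1 _ h3 h4 using h
  refine .of_isOpen_of_ae (isOpen_iInter_of_finite h1) ?_
    (fun e he i => h4 i e (Set.mem_iInter.1 he i))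
  simp only [Set.mem_iInter]
  exact ae_all_iff.2 h3

/-- A linear family of linear maps that is injective on `W` at one parameter is injective on `W`
at a generic parameter. -/
theorem holdsGenerically_injOn_of_exists {E : Type*} [NormedAddCommGroup E] [NormedSpace ℝ E]
    [FiniteDimensional ℝ E] [MeasureSpace E] [BorelSpace E]
    [(volume : Measure E).IsAddHaarMeasure] {F G : Type*} [AddCommGroup F] [Module ℝ F]
    [FiniteDimensional ℝ F] [AddCommGroup G] [Module ℝ G] (L : E →ₗ[ℝ] F →ₗ[ℝ] G)
    (W : Submodule ℝ F) (e₀ : E) (h₀ : ∀ w ∈ W, L e₀ w = 0 → w = 0) :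
    HoldsGenerically (fun e => ∀ w ∈ W, L e w = 0 → w = 0) := by
  obtain ⟨Φ, hΦ⟩ := ((L e₀).domRestrict W).exists_leftInverse_of_injective (by
    rw [LinearMap.ker_eq_bot']
    exact fun w hw => Subtype.ext (h₀ w w.2 hw))
  -- `N e = Φ ∘ L e` restricted to `W`, so that `N e₀ = 1`
  let N : E →ₗ[ℝ] Module.End ℝ W :=
    { toFun := fun e => Φ ∘ₗ (L e).domRestrict W
      map_add' := fun e e' => by ext w; simp
      map_smul' := fun c e => by ext w; simp }
  have hN₀ : N e₀ = 1 := hΦ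
  have hcont : Continuous fun e => LinearMap.det (N e) := by
    let b := Module.finBasis ℝ W
    have h1 : Continuous ((LinearMap.toMatrix b b).toLinearMap ∘ₗ N) :=
      LinearMap.continuous_of_finiteDimensional _
    have h2 := h1.matrix_det
    simpa using h2
  have hopen : IsOpen {e | LinearMap.det (N e) ≠ 0} := isOpen_ne_fun hcont continuous_const
  refine .of_isOpen_of_ae hopen ?_ ?_
  · refine ae_mem_of_ae_add_linearMap_mem (LinearMap.toSpanSingleton ℝ E e₀)
      (volume : Measure ℝ) volume hopen.measurableSet fun e => ?_
    -- `det (N e + t)` vanishes only when `-t` is in the spectrum of `N e`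
    have hfin : (Neg.neg ⁻¹' spectrum ℝ (N e)).Finite :=
      (Module.End.finite_spectrum (N e)).preimage neg_injective.injOn
    have hae : ∀ᵐ t : ℝ, t ∉ Neg.neg ⁻¹' spectrum ℝ (N e) :=
      measure_eq_zero_iff_ae_notMem.1 (hfin.measure_zero volume)
    refine hae.mono fun t ht => ?_
    rw [Set.mem_preimage, spectrum.notMem_iff, LinearMap.isUnit_iff_isUnit_det] at ht
    rw [Set.mem_ofPred_eq, ← isUnit_iff_ne_zero]
    have h3 : algebraMap ℝ (Module.End ℝ W) (-t) - N e
        = -N (e + LinearMap.toSpanSingleton ℝ E e₀ t) := by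
      simp [hN₀, Algebra.algebraMap_eq_smul_one]
      abel
    rw [h3, ← LinearMap.isUnit_iff_isUnit_det] at ht
    exact (LinearMap.isUnit_iff_isUnit_det _).1 (by simpa using ht.neg)
  · intro e he w hw hLw
    have h4 : IsUnit (N e) := (LinearMap.isUnit_iff_isUnit_det _).2 (isUnit_iff_ne_zero.2 he)
    have h5 : N e ⟨w, hw⟩ = 0 := by simp [N, hLw]
    have h6 := ((Module.End.isUnit_iff _).1 h4).1 (h5.trans (map_zero _).symm)
    exact congrArg Subtype.val h6

instance isAddHaarMeasure_volume_measurementParameters (m d : ℕ) :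
    (volume : Measure ((Fin m → Fin d → ℝ) × (Fin m → ℝ))).IsAddHaarMeasure := by
  have : (volume : Measure (Fin m → Fin d → ℝ)).IsAddHaarMeasure :=
    Measure.pi.isAddHaarMeasure fun _ => (volume : Measure (Fin d → ℝ))
  exact Measure.prod.instIsAddHaarMeasure (volume : Measure (Fin m → Fin d → ℝ))
    (volume : Measure (Fin m → ℝ))

/-! ### The split linear system -/

/-- The linear system in `(u, v, τ)` attached to a set `I` of indices: the left-hand side of
equation `j` is `⟨a_j, u⟩` if `j ∈ I` and `⟨a_j, v⟩ + τ b_j` if `j ∉ I`. It is linear in the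
parameter `(A, b)`. -/
noncomputable def splitSystem {m d : ℕ} (I : Finset (Fin m)) :
    ((Fin m → Fin d → ℝ) × (Fin m → ℝ)) →ₗ[ℝ]
      ((Fin d → ℝ) × (Fin d → ℝ) × ℝ) →ₗ[ℝ] (Fin m → ℝ) :=
  LinearMap.mk₂ ℝ
    (fun p w j => if j ∈ I then p.1 j ⬝ᵥ w.1 else p.1 j ⬝ᵥ w.2.1 + w.2.2 * p.2 j)
    (fun p p' w => by
      ext j; simp only [Pi.add_apply, Prod.fst_add, Prod.snd_add, add_dotProduct]
      split_ifs <;> ring)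
    (fun c p w => by
      ext j; simp only [Pi.smul_apply, Prod.smul_fst, Prod.smul_snd, smul_dotProduct, smul_eq_mul]
      split_ifs <;> ring)
    (fun p w w' => by
      ext j; simp only [Pi.add_apply, Prod.fst_add, Prod.snd_add, dotProduct_add]
      split_ifs <;> ring)
    (fun c p w => by
      ext j; simp only [Pi.smul_apply, Prod.smul_fst, Prod.smul_snd, dotProduct_smul, smul_eq_mul]
      split_ifs <;> ring)

theorem splitSystem_apply {m d : ℕ} (I : Finset (Fin m)) (p : (Fin m → Fin d → ℝ) × (Fin m → ℝ))
    (w : (Fin d → ℝ) × (Fin d → ℝ) × ℝ) (j : Fin m) :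
    splitSystem I p w j =
      if j ∈ I then p.1 j ⬝ᵥ w.1 else p.1 j ⬝ᵥ w.2.1 + w.2.2 * p.2 j := rfl

theorem Finset.exists_forall_mem_exists_eq_of_card_le {α β : Type*} [Nonempty β] (s : Finset α)
    (t : Finset β) (h : t.card ≤ s.card) : ∃ g : α → β, ∀ y ∈ t, ∃ x ∈ s, g x = y := by
  classical
  obtain ⟨f⟩ : Nonempty (t ↪ s) := Function.Embedding.nonempty_of_card_le (by simpa using h)
  let k : t → α := fun y => f y
  have hk : Function.Injective k := Subtype.val_injective.comp f.injective
  refine ⟨Function.extend k (fun y => (y : β)) (fun _ => Classical.arbitrary β),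
    fun y hy => ⟨f ⟨y, hy⟩, (f ⟨y, hy⟩).2, ?_⟩⟩
  exact hk.extend_apply _ _ ⟨y, hy⟩

/-- With coordinate functionals as rows, the split system can be made to kill `u` on any set `C`
of coordinates with `|C| ≤ |I|`, and any set `D` of coordinates of `(v, τ)` with `|D| ≤ |Iᶜ|`;
here `none` stands for the coordinate `τ`. -/
theorem exists_eq_zero_of_splitSystem_eq_zero {m d : ℕ} (I : Finset (Fin m)) (C : Finset (Fin d))
    (D : Finset (Option (Fin d))) (hC : C.card ≤ I.card) (hD : D.card ≤ Iᶜ.card) :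
    ∃ p : (Fin m → Fin d → ℝ) × (Fin m → ℝ), ∀ w, splitSystem I p w = 0 →
      (∀ i ∈ C, w.1 i = 0) ∧ ∀ o ∈ D, Option.elim o w.2.2 w.2.1 = 0 := by
  obtain ⟨g, hg⟩ := I.exists_forall_mem_exists_eq_of_card_le (C.map .some) (by simpa using hC)
  obtain ⟨k, hk⟩ := Iᶜ.exists_forall_mem_exists_eq_of_card_le D hD
  let f : Fin m → Option (Fin d) := fun j => if j ∈ I then g j else k j
  refine ⟨(fun j i => if f j = some i then 1 else 0, fun j => if f j = none then 1 else 0),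
    fun w hw => ⟨fun i hi => ?_, fun o ho => ?_⟩⟩
  · obtain ⟨j, hj, hji⟩ := hg (some i) (by simpa using hi)
    have := congrFun hw j
    simpa [splitSystem_apply, hj, f, hji, dotProduct] using this
  · obtain ⟨j, hj, hjo⟩ := hk o ho
    rw [Finset.mem_compl] at hj
    have := congrFun hw j
    cases o <;> simpa [splitSystem_apply, hj, f, hjo, dotProduct] using this

/-- For given supports and a given split of the indices, generically no two distinct vectors
satisfy the corresponding sign equations. -/
theorem holdsGenerically_eq_of_split {m d s : ℕ} (hm : 2 * s + 1 ≤ m) (I : Finset (Fin m))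
    (S T : Finset (Fin d)) (hS : S.card ≤ s) (hT : T.card ≤ s) :
    HoldsGenerically (fun p : (Fin m → Fin d → ℝ) × (Fin m → ℝ) =>
      ∀ x y : Fin d → ℝ, (∀ i ∉ S, x i = 0) → (∀ i ∉ T, y i = 0) →
        splitSystem I p (x - y, x + y, 2) = 0 → x = y) := by
  have hcard := Finset.card_union_add_card_inter S T
  have hI := Finset.card_compl_add_card I
  rw [Fintype.card_fin] at hI
  rcases le_or_gt (S ∪ T).card I.card with h1 | h1
  · -- The equations indexed by `I` force `u = 0`.
    let W : Submodule ℝ ((Fin d → ℝ) × (Fin d → ℝ) × ℝ) :=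
      { carrier := {w | (∀ i ∉ S ∪ T, w.1 i = 0) ∧ w.2 = 0}
        zero_mem' := by simp
        add_mem' := fun {w w'} h h' =>
          ⟨fun i hi => by simp [h.1 i hi, h'.1 i hi], by simp [h.2, h'.2]⟩
        smul_mem' := fun c w h => ⟨fun i hi => by simp [h.1 i hi], by simp [h.2]⟩ }
    obtain ⟨p₀, hp₀⟩ := exists_eq_zero_of_splitSystem_eq_zero I (S ∪ T) ∅ h1 (by simp)
    refine (holdsGenerically_injOn_of_exists (splitSystem I) W p₀ ?_).mono ?_
    · intro w hw hw0
      refine Prod.ext (funext fun i => ?_) hw.2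
      by_cases hi : i ∈ S ∪ T
      · exact (hp₀ w hw0).1 i hi
      · exact hw.1 i hi
    · intro p hp x y hx hy hxy
      have := hp (x - y, 0, 0) ⟨fun i hi => ?_, rfl⟩ ?_
      · exact sub_eq_zero.1 (congrArg Prod.fst this)
      · rw [Finset.notMem_union] at hi
        simp [hx i hi.1, hy i hi.2]
      · ext j
        have h2 := congrFun hxy j
        rw [splitSystem_apply] at h2 ⊢
        split_ifs at h2 ⊢ with hj
        · exact h2
        · simp
  rcases lt_or_ge I.card (S ∩ T).card with h2 | h2
  · -- The equations outside `I` have no solution `v`.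
    let W : Submodule ℝ ((Fin d → ℝ) × (Fin d → ℝ) × ℝ) :=
      { carrier := {w | w.1 = 0 ∧ ∀ i ∉ S ∪ T, w.2.1 i = 0}
        zero_mem' := by simp
        add_mem' := fun {w w'} h h' =>
          ⟨by simp [h.1, h'.1], fun i hi => by simp [h.2 i hi, h'.2 i hi]⟩
        smul_mem' := fun c w h => ⟨by simp [h.1], fun i hi => by simp [h.2 i hi]⟩ }
    obtain ⟨p₀, hp₀⟩ := exists_eq_zero_of_splitSystem_eq_zero I ∅ (S ∪ T).insertNone (by simp)
      (by rw [Finset.card_insertNone]; omega)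
    refine (holdsGenerically_injOn_of_exists (splitSystem I) W p₀ ?_).mono ?_
    · intro w hw hw0
      have h3 := (hp₀ w hw0).2
      refine Prod.ext hw.1 (Prod.ext (funext fun i => ?_) (h3 none (by simp)))
      by_cases hi : i ∈ S ∪ T
      · exact h3 (some i) (Finset.some_mem_insertNone.2 hi)
      · exact hw.2 i hi
    · intro p hp x y hx hy hxy
      have := hp (0, x + y, 2) ⟨rfl, fun i hi => ?_⟩ ?_
      · simp at this
      · rw [Finset.notMem_union] at hi
        simp [hx i hi.1, hy i hi.2]
      · ext j
        have h2 := congrFun hxy j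
        rw [splitSystem_apply] at h2 ⊢
        split_ifs at h2 ⊢ with hj
        · simp
        · exact h2
  · -- The whole system is injective. The equations in `I` can kill `u` on a set `C` with
    -- `S ∩ T ⊆ C ⊆ S ∪ T` and `|C| = |I|`; the others kill `τ`, and `v` on
    -- `S ∩ T` and on `(S ∪ T) \ C`. Off `S ∩ T` one has `u = ± v`, so all of `u`, `v` is killed.
    let W : Submodule ℝ ((Fin d → ℝ) × (Fin d → ℝ) × ℝ) :=
      { carrier := {w | (∀ i ∉ S, w.1 i + w.2.1 i = 0) ∧ ∀ i ∉ T, w.2.1 i - w.1 i = 0}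
        zero_mem' := by simp
        add_mem' := fun {w w'} h h' =>
          ⟨fun i hi => by simp; linarith [h.1 i hi, h'.1 i hi],
            fun i hi => by simp; linarith [h.2 i hi, h'.2 i hi]⟩
        smul_mem' := fun c w h =>
          ⟨fun i hi => by simp [← mul_add, h.1 i hi], fun i hi => by simp [← mul_sub, h.2 i hi]⟩ }
    obtain ⟨C, hC1, hC2, hC3⟩ := Finset.exists_subsuperset_card_eq
      (Finset.inter_subset_left.trans Finset.subset_union_left : S ∩ T ⊆ S ∪ T) h2 h1.le
    have hD : (((S ∪ T) \ C) ∪ (S ∩ T)).insertNone.card ≤ Iᶜ.card := by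
      rw [Finset.card_insertNone]
      have h3 := Finset.card_union_le ((S ∪ T) \ C) (S ∩ T)
      rw [Finset.card_sdiff_of_subset hC2] at h3
      omega
    obtain ⟨p₀, hp₀⟩ := exists_eq_zero_of_splitSystem_eq_zero I C _ hC3.le hD
    refine (holdsGenerically_injOn_of_exists (splitSystem I) W p₀ ?_).mono ?_
    · intro w hw hw0
      obtain ⟨hu, hv⟩ := hp₀ w hw0
      have key : ∀ i, w.1 i = 0 ∧ w.2.1 i = 0 := by
        intro i
        have h5 := hw.1 i
        have h6 := hw.2 i
        have h7 := hu i
        have h8 : i ∈ ((S ∪ T) \ C) ∪ (S ∩ T) → w.2.1 i = 0 := fun h =>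
          hv (some i) (Finset.some_mem_insertNone.2 h)
        simp only [Finset.mem_union, Finset.mem_sdiff, Finset.mem_inter] at h8
        have h9 : i ∈ S → i ∈ T → i ∈ C := fun h h' => hC1 (Finset.mem_inter.2 ⟨h, h'⟩)
        by_cases hiS : i ∈ S
        · by_cases hiT : i ∈ T
          · exact ⟨h7 (h9 hiS hiT), h8 (.inr ⟨hiS, hiT⟩)⟩
          · have h10 := h6 hiT
            by_cases hiC : i ∈ C
            · exact ⟨h7 hiC, by linarith [h7 hiC]⟩
            · have h11 := h8 (.inl ⟨.inl hiS, hiC⟩)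
              exact ⟨by linarith, h11⟩
        · have h10 := h5 hiS
          by_cases hiT : i ∈ T
          · by_cases hiC : i ∈ C
            · exact ⟨h7 hiC, by linarith [h7 hiC]⟩
            · have h11 := h8 (.inl ⟨.inr hiT, hiC⟩)
              exact ⟨by linarith, h11⟩
          · have h11 := h6 hiT
            constructor <;> linarith
      exact Prod.ext (funext fun i => (key i).1)
        (Prod.ext (funext fun i => (key i).2) (hv none (by simp)))
    · intro p hp x y hx hy hxy
      have := hp (x - y, x + y, 2) ⟨fun i hi => ?_, fun i hi => ?_⟩ hxy
      · simp at this
      · simp [hx i hi]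
      · simp [hy i hi]

/-- The sign equations hold for `I` the set of indices where the signed measurements agree. -/
theorem exists_splitSystem_eq_zero_of_affineMeasurement_eq {m d : ℕ}
    (p : (Fin m → Fin d → ℝ) × (Fin m → ℝ)) (x y : Fin d → ℝ)
    (h : affineMeasurement p.1 p.2 x = affineMeasurement p.1 p.2 y) :
    ∃ I, splitSystem I p (x - y, x + y, 2) = 0 := by
  classical
  refine ⟨Finset.univ.filter fun j => p.1 j ⬝ᵥ x + p.2 j = p.1 j ⬝ᵥ y + p.2 j, ?_⟩
  ext j
  rw [splitSystem_apply]
  have hj : |p.1 j ⬝ᵥ x + p.2 j| = |p.1 j ⬝ᵥ y + p.2 j| := congrFun h j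
  simp only [Finset.mem_filter, Finset.mem_univ, true_and, dotProduct_sub, dotProduct_add,
    Pi.zero_apply]
  split_ifs with hc
  · linarith
  · linarith [(abs_eq_abs.1 hj).resolve_left hc]

theorem holdsGenerically_isSparseAffinePhaseRetrievable {m d s : ℕ} (hm : 2 * s + 1 ≤ m) :
    HoldsGenerically (fun p : (Fin m → Fin d → ℝ) × (Fin m → ℝ) =>
      IsSparseAffinePhaseRetrievable s p.1 p.2) := by
  have h := HoldsGenerically.forall_finite (E := (Fin m → Fin d → ℝ) × (Fin m → ℝ))
    (ι := Finset (Fin m) × {S : Finset (Fin d) // S.card ≤ s} × {S : Finset (Fin d) // S.card ≤ s})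
    fun q => holdsGenerically_eq_of_split (d := d) hm q.1 q.2.1.1 q.2.2.1 q.2.1.2 q.2.2.2
  refine h.mono fun p hp x hx y hy hxy => ?_
  obtain ⟨I, hI⟩ := exists_splitSystem_eq_zero_of_affineMeasurement_eq p x y hxy
  exact hp (I, ⟨Finset.univ.filter (x · ≠ 0), hx⟩, ⟨Finset.univ.filter (y · ≠ 0), hy⟩) x y
    (by simp) (by simp) hI

/-! ### Necessity of `m ≥ 2 s + 1` -/

/-- If the space `K` contains, for every `k`, a nonzero vector vanishing at `k`, then for every `v`
some nonzero `u ∈ K` makes both `u + v` and `v - u` vanish at some coordinate. -/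
theorem exists_ne_zero_add_eq_zero_and_sub_eq_zero {ι : Type*} [Nonempty ι]
    (K : Submodule ℝ (ι → ℝ)) (hK : ∀ k, ∃ u ∈ K, u ≠ 0 ∧ u k = 0) (v : ι → ℝ) :
    ∃ u ∈ K, u ≠ 0 ∧ (∃ i, u i + v i = 0) ∧ ∃ k, v k - u k = 0 := by
  by_cases hv : ∃ k, v k = 0
  · obtain ⟨k, hk⟩ := hv
    obtain ⟨u, huK, hu, huk⟩ := hK k
    exact ⟨u, huK, hu, ⟨k, by simp [hk, huk]⟩, ⟨k, by simp [hk, huk]⟩⟩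
  push Not at hv
  -- `w k ≠ 0`, `u k = 0` and `u i ≠ 0`, so the coordinates `(i, k)` map `span {u, w}` onto the plane.
  obtain ⟨w, hwK, hw, -⟩ := hK (Classical.arbitrary ι)
  obtain ⟨k, hk⟩ := Function.ne_iff.1 hw
  obtain ⟨u, huK, hu, huk⟩ := hK k
  obtain ⟨i, hi⟩ := Function.ne_iff.1 hu
  simp only [Pi.zero_apply] at hk hi
  have hzk : (((-v i - v k / w k * w i) / u i) • u + (v k / w k) • w) k = v k := by
    simp [huk, hk]
  refine ⟨((-v i - v k / w k * w i) / u i) • u + (v k / w k) • w,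
    K.add_mem (K.smul_mem _ huK) (K.smul_mem _ hwK), ?_, ⟨i, ?_⟩, ⟨k, sub_eq_zero.2 hzk.symm⟩⟩
  · intro h0
    rw [h0] at hzk
    exact hv k hzk.symm
  · simp [hi]

theorem hammingNorm_le_of_apply_eq_zero {s : ℕ} {x : Fin (s + 1) → ℝ} {i : Fin (s + 1)}
    (h : x i = 0) : hammingNorm x ≤ s := by
  have h1 : (Finset.univ.filter (x · ≠ 0)).card < (Finset.univ : Finset (Fin (s + 1))).card :=
    Finset.card_lt_card (Finset.filter_ssubset.2 ⟨i, Finset.mem_univ i, by simpa using h⟩)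
  rw [Finset.card_fin] at h1
  exact Nat.lt_succ_iff.1 h1

/-- The rows of a matrix with trivial kernel contain a basis: the corresponding equations
can be solved with any right-hand side. -/
theorem exists_card_eq_forall_exists_dotProduct_eq {m n : ℕ} (A : Fin m → Fin n → ℝ)
    (hA : ∀ z : Fin n → ℝ, (∀ j, A j ⬝ᵥ z = 0) → z = 0) :
    ∃ J : Finset (Fin m), J.card = n ∧
      ∀ c : Fin m → ℝ, ∃ v : Fin n → ℝ, ∀ j ∈ J, A j ⬝ᵥ v = c j := by
  classical
  obtain ⟨κ, a, ha, hspan, hli⟩ := exists_linearIndependent' ℝ A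
  have : Fintype κ := Fintype.ofInjective a ha
  let f : (Fin n → ℝ) →ₗ[ℝ] (κ → ℝ) := Matrix.mulVecLin (Matrix.of fun k => A (a k))
  have hf : ∀ v k, f v k = A (a k) ⬝ᵥ v := fun v k => rfl
  have hinj : Function.Injective f := by
    rw [← LinearMap.ker_eq_bot, LinearMap.ker_eq_bot']
    refine fun z hz => hA z fun j => ?_
    have hmem : A j ∈ Submodule.span ℝ (Set.range (A ∘ a)) :=
      hspan ▸ Submodule.subset_span (Set.mem_range_self j)
    generalize A j = r at hmem
    induction hmem using Submodule.span_induction with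
    | mem r hr => obtain ⟨k, rfl⟩ := hr; exact (hf z k).symm.trans (congrFun hz k)
    | zero => simp
    | add r r' _ _ h h' => rw [add_dotProduct, h, h', add_zero]
    | smul c r _ h => rw [smul_dotProduct, h, smul_zero]
  have hcard : Fintype.card κ = n := by
    have h1 := LinearMap.finrank_le_finrank_of_injective hinj
    have h2 := hli.fintype_card_le_finrank
    simp only [Module.finrank_fintype_fun_eq_card, Fintype.card_fin] at h1 h2
    omega
  have hsurj : Function.Surjective f :=
    (LinearMap.injective_iff_surjective_of_finrank_eq_finrank (by simp [hcard])).1 hinj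
  refine ⟨Finset.univ.map ⟨a, ha⟩, by simp [hcard], fun c => ?_⟩
  obtain ⟨v, hv⟩ := hsurj (c ∘ a)
  refine ⟨v, fun j hj => ?_⟩
  obtain ⟨k, -, rfl⟩ := Finset.mem_map.1 hj
  exact (hf v k).symm.trans (congrFun hv k)

/-- The case `d = s + 1` of the lower bound on the number of measurements. -/
theorem IsSparseAffinePhaseRetrievable.two_mul_add_one_le_of_succ {m s : ℕ} (hs : 1 ≤ s)
    {A : Fin m → Fin (s + 1) → ℝ} {b : Fin m → ℝ} (h : IsSparseAffinePhaseRetrievable s A b) :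
    2 * s + 1 ≤ m := by
  by_contra! hm
  by_cases hA : ∀ z : Fin (s + 1) → ℝ, (∀ j, A j ⬝ᵥ z = 0) → z = 0
  · obtain ⟨J, hJ, hsolve⟩ := exists_card_eq_forall_exists_dotProduct_eq A hA
    obtain ⟨v, hv⟩ := hsolve fun j => -2 * b j
    have hJc := Finset.card_compl_add_card J
    rw [Fintype.card_fin] at hJc
    let f : (Fin (s + 1) → ℝ) →ₗ[ℝ] ({j // j ∈ Jᶜ} → ℝ) :=
      Matrix.mulVecLin (Matrix.of fun j => A j)
    have hK : ∀ k, ∃ u ∈ LinearMap.ker f, u ≠ 0 ∧ u k = 0 := by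
      intro k
      have hlt : Module.finrank ℝ (({j // j ∈ Jᶜ} → ℝ) × ℝ) <
          Module.finrank ℝ (Fin (s + 1) → ℝ) := by
        simp only [Module.finrank_prod, Module.finrank_fintype_fun_eq_card, Fintype.card_coe,
          Module.finrank_self, Fintype.card_fin]
        omega
      obtain ⟨u, hu, hu0⟩ := Submodule.exists_mem_ne_zero_of_ne_bot
        (LinearMap.ker_ne_bot_of_finrank_lt (f := f.prod (LinearMap.proj k)) hlt)
      rw [LinearMap.ker_prod, Submodule.mem_inf] at hu
      exact ⟨u, hu.1, hu0, hu.2⟩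
    obtain ⟨u, huK, hu, ⟨i, hi⟩, ⟨k, hk⟩⟩ := exists_ne_zero_add_eq_zero_and_sub_eq_zero _ hK v
    have hxy : (2⁻¹ : ℝ) • (u + v) = (2⁻¹ : ℝ) • (v - u) := by
      refine h (hammingNorm_le_of_apply_eq_zero (i := i) (by simp [hi]))
        (hammingNorm_le_of_apply_eq_zero (i := k) (by simp [hk])) (funext fun j => ?_)
      simp only [affineMeasurement, dotProduct_smul, dotProduct_add, dotProduct_sub, smul_eq_mul]
      by_cases hj : j ∈ J
      · rw [abs_eq_abs]
        right
        linarith [hv j hj]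
      · have h0 : A j ⬝ᵥ u = 0 := congrFun huK ⟨j, Finset.mem_compl.2 hj⟩
        rw [h0, zero_add, sub_zero]
    refine hu (funext fun l => ?_)
    have hl := congrFun hxy l
    simp only [Pi.smul_apply, Pi.add_apply, Pi.sub_apply, smul_eq_mul] at hl
    simp only [Pi.zero_apply]
    linarith
  · push Not at hA
    obtain ⟨z, hz, hz0⟩ := hA
    have hs1 : Fin.last s ≠ 0 := by
      rw [Ne, Fin.ext_iff]
      simp
      omega
    have hxy : Pi.single 0 (z 0) = Pi.single 0 (z 0) - z := by
      refine h (hammingNorm_le_of_apply_eq_zero (i := Fin.last s) (by simp [hs1]))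
        (hammingNorm_le_of_apply_eq_zero (i := 0) (by simp)) (funext fun j => ?_)
      simp [affineMeasurement, dotProduct_sub, hz j]
    exact hz0 (sub_eq_self.1 hxy.symm)

/-- Sparse phase retrievability is inherited by a subset of the coordinates. -/
theorem IsSparseAffinePhaseRetrievable.comp_injective {m d n s : ℕ} {A : Fin m → Fin d → ℝ}
    {b : Fin m → ℝ} (h : IsSparseAffinePhaseRetrievable s A b) {f : Fin n → Fin d}
    (hf : Function.Injective f) : IsSparseAffinePhaseRetrievable s (fun j => A j ∘ f) b := by
  classical
  have hnorm : ∀ x : Fin n → ℝ, hammingNorm (Function.extend f x 0) ≤ hammingNorm x := by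
    intro x
    refine (Finset.card_le_card (t := (Finset.univ.filter (x · ≠ 0)).map ⟨f, hf⟩) ?_).trans
      (Finset.card_map _).le
    intro i hi
    by_cases hif : ∃ k, f k = i
    · obtain ⟨k, rfl⟩ := hif
      simpa [hf.extend_apply, hf.eq_iff] using hi
    · simp [Function.extend_apply' _ _ _ hif] at hi
  have hdot : ∀ (x : Fin n → ℝ) (j : Fin m),
      A j ⬝ᵥ Function.extend f x 0 = (A j ∘ f) ⬝ᵥ x := by
    intro x j
    refine (Fintype.sum_of_injective f hf _ _ (fun i hi => ?_) fun k => ?_).symm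
    · have : ¬∃ k, f k = i := hi
      simp [Function.extend_apply' _ _ _ this]
    · simp [hf.extend_apply]
  intro x hx y hy hxy
  have key := h ((hnorm x).trans hx) ((hnorm y).trans hy) (funext fun j => by
    simpa only [affineMeasurement, hdot] using congrFun hxy j)
  funext k
  simpa only [hf.extend_apply] using congrFun key (f k)

theorem mainTheorem7 (m d s : ℕ) :
    (1 ≤ s → s < d → ∀ (A : Fin m → Fin d → ℝ) (b : Fin m → ℝ),
      IsSparseAffinePhaseRetrievable s A b → 2 * s + 1 ≤ m) ∧
    (2 * s + 1 ≤ m →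
      HoldsGenerically (fun p : (Fin m → Fin d → ℝ) × (Fin m → ℝ) =>
        IsSparseAffinePhaseRetrievable s p.1 p.2)) :=
  ⟨fun hs hsd _ _ h => (IsSparseAffinePhaseRetrievable.comp_injective h
      (Fin.castLE_injective (Nat.succ_le_of_lt hsd))).two_mul_add_one_le_of_succ hs,
    holdsGenerically_isSparseAffinePhaseRetrievable⟩
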